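/- Let $N\ge 0$ be an integer, let $\sigma\in\{1,-1\}$, and let $p_i,\alpha_i,\xi_{i0}$ $(i=1,\dots,N)$ be arbitrary complex parameters such that $p_i\neq 0$ for all $i$ and $p_i+p_j^*\neq 0$ for all $i,j$, where $^*$ denotes complex conjugation. For real $x,t$ put $$\xi_i=p_i x-\frac{1}{p_i}t+\xi_{i0},$$ let $A=(a_{ij})$, $A'=(a'_{ij})$, $B=(b_{ij})$ be the $N\times N$ matrices with entries $$a_{ij}=\frac{\mathrm i\,p_i}{p_i+p_j^*}e^{\xi_i+\xi_j^*},\qquad a'_{ij}=-\frac{\mathrm i\,p_j^*}{p_i+p_j^*}e^{\xi_i+\xi_j^*},\qquad b_{ij}=\frac{\sigma\alpha_i\alpha_j^*}{p_i^*+p_j},$$ let $I$ be the $N\times N$ identity matrix, let $\mathbf 0$ be the zero row vector of length $N$, and let $\Phi=(e^{\xi_1},\dots,e^{\xi_N})$, $C^*=(\alpha_1^*,\dots,\alpha_N^*)$ and $D=(\alpha_1^*/p_1,\dots,\alpha_N^*/p_N)$. Define $$f=\begin{vmatrix}A&I\\-I&B\end{vmatrix},\qquad g=-\mathrm i\begin{vmatrix}A'&I&\Phi^T\\-I&B&\mathbf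 0^T\\ \mathbf 0&D&0\end{vmatrix},\qquad h=\begin{vmatrix}A'&I&\Phi^T\\-I&B&\mathbf 0^T\\ \mathbf 0&-C^*&0\end{vmatrix}.$$ Then for all $(x,t)\in\mathbb R^2$ one has $f(x,t)\ne 0$, and the complex conjugate of $f$ is $$f^*=\begin{vmatrix}A'&I\\-I&B\end{vmatrix};$$ moreover the functions $$u=\frac{g}{f^*},\qquad v=\frac{h}{f}$$ are continuously differentiable on $\mathbb R^2$ and solve the massive Thirring model $$\mathrm i\,u_x+v+\sigma u|v|^2=0,\qquad \mathrm i\,v_t+u+\sigma v|u|^2=0$$ at every point $(x,t)\in\mathbb R^2$. -/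

import Mathlib

open scoped ComplexConjugate

noncomputable section

namespace MassiveThirring

/-- `(u, v)` is a classical (`C¹`) solution on the whole `(x, t)`-plane of the massive Thirring model
`i u_x + v + σ u |v|² = 0`, `i v_t + u + σ v |u|² = 0`. -/
structure IsSolution (σ : ℝ) (u v : ℝ → ℝ → ℂ) : Prop where
  contDiff_u : ContDiff ℝ 1 (fun z : ℝ × ℝ => u z.1 z.2)
  contDiff_v : ContDiff ℝ 1 (fun z : ℝ × ℝ => v z.1 z.2)
  eq_u : ∀ x t : ℝ,
    Complex.I * deriv (fun y => u y t) x + v x t + (σ : ℂ) * u x t * ((‖v x t‖ ^ 2 : ℝ) : ℂ) = 0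
  eq_v : ∀ x t : ℝ,
    Complex.I * deriv (fun s => v x s) t + u x t + (σ : ℂ) * v x t * ((‖u x t‖ ^ 2 : ℝ) : ℂ) = 0

variable {N : ℕ}

/-- The phases `ξ_i = p_i x - t / p_i + ξ_{i0}`. -/
def xi (p ξ₀ : Fin N → ℂ) (x t : ℝ) (i : Fin N) : ℂ :=
  p i * (x : ℂ) - 1 / p i * (t : ℂ) + ξ₀ i

/-- The matrix `A`, with entries `i p_i e^{ξ_i + ξ_j^*} / (p_i + p_j^*)`. -/
def matA (p ξ₀ : Fin N → ℂ) (x t : ℝ) : Matrix (Fin N) (Fin N) ℂ :=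
  Matrix.of fun i j =>
    Complex.I * p i / (p i + conj (p j)) * Complex.exp (xi p ξ₀ x t i + conj (xi p ξ₀ x t j))

/-- The matrix `A'`, with entries `-i p_j^* e^{ξ_i + ξ_j^*} / (p_i + p_j^*)`. -/
def matA' (p ξ₀ : Fin N → ℂ) (x t : ℝ) : Matrix (Fin N) (Fin N) ℂ :=
  Matrix.of fun i j =>
    -(Complex.I * conj (p j) / (p i + conj (p j))) *
      Complex.exp (xi p ξ₀ x t i + conj (xi p ξ₀ x t j))

/-- The matrix `B`, with entries `σ α_i α_j^* / (p_i^* + p_j)`. -/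
def matB (σ : ℝ) (p α : Fin N → ℂ) : Matrix (Fin N) (Fin N) ℂ :=
  Matrix.of fun i j => (σ : ℂ) * α i * conj (α j) / (conj (p i) + p j)

/-- The vector `Φ = (e^{ξ_1}, …, e^{ξ_N})`. -/
def Phi (p ξ₀ : Fin N → ℂ) (x t : ℝ) : Fin N → ℂ :=
  fun i => Complex.exp (xi p ξ₀ x t i)

/-- The block determinant `|M I; -I B|`. -/
def blockDet (M B : Matrix (Fin N) (Fin N) ℂ) : ℂ :=
  (Matrix.fromBlocks M 1 (-1) B).det

/-- The bordered block determinant `|M I cᵀ; -I B 0ᵀ; 0 r 0|`. -/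
def borderedDet (M B : Matrix (Fin N) (Fin N) ℂ) (c r : Fin N → ℂ) : ℂ :=
  (Matrix.fromBlocks (Matrix.fromBlocks M 1 (-1) B)
    (Matrix.replicateCol Unit (Sum.elim c 0))
    (Matrix.replicateRow Unit (Sum.elim 0 r))
    0).det

/-- `f = |A I; -I B|`. -/
def tauF (σ : ℝ) (p α ξ₀ : Fin N → ℂ) (x t : ℝ) : ℂ :=
  blockDet (matA p ξ₀ x t) (matB σ p α)

/-- The determinant `|A' I; -I B|` that represents `f^*`. -/
def tauFStar (σ : ℝ) (p α ξ₀ : Fin N → ℂ) (x t : ℝ) : ℂ :=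
  blockDet (matA' p ξ₀ x t) (matB σ p α)

/-- `g = -i |A' I Φᵀ; -I B 0ᵀ; 0 r 0|` with `r_j = α_j^* / p_j`. -/
def tauG (σ : ℝ) (p α ξ₀ : Fin N → ℂ) (x t : ℝ) : ℂ :=
  -Complex.I * borderedDet (matA' p ξ₀ x t) (matB σ p α) (Phi p ξ₀ x t)
    (fun j => conj (α j) / p j)

/-- `h = |A' I Φᵀ; -I B 0ᵀ; 0 -C^* 0|` with `C = (α_1, …, α_N)`. -/
def tauH (σ : ℝ) (p α ξ₀ : Fin N → ℂ) (x t : ℝ) : ℂ :=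
  borderedDet (matA' p ξ₀ x t) (matB σ p α) (Phi p ξ₀ x t) (fun j => -conj (α j))

end MassiveThirring

end

/-! ### Block determinants, rank-one updates and derivatives of inverse matrices -/

namespace MassiveThirring

open Matrix

variable {n : Type*} [Fintype n]

/-! Let P = diag(p), a = α, φ = Φ, and let M be the Hermitian matrix with entries e^{ξ_i + ξ_j^*} /
(p_i + p_j^*). Then A = iPM and A' = -iMP†, and the algebra rests on two Lyapunov equations
(`Reduction`): PM + MP† = φφ† and P†B + BP = σaa†. Put F = 1 + AB and G = 1 + A'B, so that f = det F
and f* = det G. The Lyapunov equations make F - G and FP - PG rank-one, which ties F⁻¹ to G⁻¹ and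
gives u = i a†P⁻¹G⁻¹φ and v = a†F⁻¹φ.

Since M_x = φφ†, φ_x = Pφ, M_t = -P⁻¹φφ†(P⁻¹)† and φ_t = -P⁻¹φ, differentiation turns the two
equations into the matrix identities `Reduction.eq_u` and `Reduction.eq_v`. Their cubic terms come
from sandwiching the Lyapunov equation for B between inverses, together with |κ| = 1 for κ = f/f*.

For f ≠ 0 no definiteness of M is available. Instead, real parts of quadratic forms show that the
kernel of 1 + iBPM is P†-invariant and that MP† = -PM on it (`Reduction.ker_invariant`). The spectra
of P† and -P are disjoint because p_i + p_j^* ≠ 0, so M kills this kernel, which is therefore zero.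
-/

theorem dotProduct_mul_vecMulVec_mul_mulVec (r c d e : n → ℂ) (X Y : Matrix n n ℂ) :
    r ⬝ᵥ (X * vecMulVec c d * Y) *ᵥ e = (r ⬝ᵥ X *ᵥ c) * (d ⬝ᵥ Y *ᵥ e) := by
  rw [← mulVec_mulVec, ← mulVec_mulVec, vecMulVec_mulVec]
  simp [mulVec_smul, mul_comm]

theorem star_dotProduct_mulVec (a c : n → ℂ) (X : Matrix n n ℂ) :
    conj (star a ⬝ᵥ X *ᵥ c) = star c ⬝ᵥ Xᴴ *ᵥ a := by
  rw [starRingEnd_apply, star_dotProduct, star_star, star_mulVec, ← dotProduct_mulVec]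

variable [DecidableEq n]

theorem det_fromBlocks_one_neg_one (M B : Matrix n n ℂ) :
    (fromBlocks M 1 (-1) B).det = (1 + M * B).det := by
  -- A row operation of determinant one makes the lower right block 1, so the Schur complement needs
  -- no invertibility of `M` or `B`.
  have h : fromBlocks 1 0 (1 - B) 1 * fromBlocks M 1 (-1) B =
      fromBlocks M 1 ((1 - B) * M - 1) 1 := by
    rw [fromBlocks_multiply]
    congr 1 <;> noncomm_ring
  have h' := congrArg det h
  rw [det_mul, det_fromBlocks_zero₁₂, det_fromBlocks_one₂₂] at h'
  rw [det_one, one_mul, one_mul] at h'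
  rw [h', det_one_add_mul_comm]
  congr 1
  noncomm_ring

/-- Schur complement with respect to the inner block matrix. Only its inverse applied to (c, 0)
matters, and that vector is (By, y) with y = (1 + MB)⁻¹c. -/
theorem det_bordered (M B : Matrix n n ℂ) (c r : n → ℂ) (h : (1 + M * B).det ≠ 0) :
    (fromBlocks (fromBlocks M 1 (-1) B) (replicateCol Unit (Sum.elim c 0))
      (replicateRow Unit (Sum.elim 0 r)) 0).det =
    -((1 + M * B).det * (r ⬝ᵥ (1 + M * B)⁻¹ *ᵥ c)) := by
  set X := fromBlocks M 1 (-1) B with hX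
  have hdet : X.det = (1 + M * B).det := det_fromBlocks_one_neg_one M B
  have hu : IsUnit X.det := by rw [hdet]; exact h.isUnit
  let := X.invertibleOfIsUnitDet hu
  set y := (1 + M * B)⁻¹ *ᵥ c with hy
  have hy' : (1 + M * B) *ᵥ y = c := by
    rw [hy, mulVec_mulVec, mul_nonsing_inv _ h.isUnit, one_mulVec]
  have hz : X * replicateCol Unit (Sum.elim (B *ᵥ y) y) = replicateCol Unit (Sum.elim c 0) := by
    rw [← replicateCol_mulVec, hX, fromBlocks_mulVec]
    congr 1
    simp only [Sum.elim_comp_inl, Sum.elim_comp_inr]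
    congr 1
    · rw [← hy', add_mulVec, mulVec_mulVec, add_comm]
    · simp [neg_mulVec]
  rw [det_fromBlocks₁₁, ← hz, Matrix.mul_assoc, ← Matrix.mul_assoc (⅟X), invOf_mul_self,
    Matrix.one_mul, hdet]
  simp [det_unique, Matrix.mul_apply, dotProduct]

theorem det_one_add_smul_mul_vecMulVec (c d : n → ℂ) (X : Matrix n n ℂ) (s : ℂ) :
    (1 + s • (X * vecMulVec c d)).det = 1 + s * (d ⬝ᵥ X *ᵥ c) := by
  rw [mul_vecMulVec, ← smul_vecMulVec, vecMulVec_eq Unit, det_one_add_replicateCol_mul_replicateRow]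
  simp [dotProduct_smul]

section
open scoped Matrix.Norms.Operator

/-- The operator norm supplies the normed algebra in which inversion has derivative H ↦ -X⁻¹HX⁻¹.
Hypotheses and conclusion are scalar, so no matrix norm enters the statement. -/
theorem hasDerivAt_dotProduct_inv_mulVec {X : ℝ → Matrix n n ℂ} {X' : Matrix n n ℂ}
    {c : ℝ → n → ℂ} {c' : n → ℂ} {t : ℝ} (r : n → ℂ)
    (hX : ∀ i j, HasDerivAt (fun s => X s i j) (X' i j) t)
    (hc : ∀ i, HasDerivAt (fun s => c s i) (c' i) t) (hdet : (X t).det ≠ 0) :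
    HasDerivAt (fun s => r ⬝ᵥ (X s)⁻¹ *ᵥ c s)
      (r ⬝ᵥ (X t)⁻¹ *ᵥ c' - r ⬝ᵥ ((X t)⁻¹ * X' * (X t)⁻¹) *ᵥ c t) t := by
  have hXm : HasDerivAt X X' t := hasDerivAt_pi.2 fun i => hasDerivAt_pi.2 fun j => hX i j
  have hu : IsUnit (X t) := (Matrix.isUnit_iff_isUnit_det _).2 hdet.isUnit
  have hinv : HasDerivAt (fun s => (X s)⁻¹) (-((X t)⁻¹ * X' * (X t)⁻¹)) t := by
    have h1 := (hasFDerivAt_ringInverse (𝕜 := ℝ) hu.unit)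
    have h2 := h1.comp_hasDerivAt_of_eq t hXm (by simp)
    have h3 : (Ring.inverse ∘ X) = fun s => (X s)⁻¹ := by
      ext1 s; simp [nonsing_inv_eq_ringInverse]
    rw [h3] at h2
    have h4 : ((hu.unit⁻¹ : (Matrix n n ℂ)ˣ) : Matrix n n ℂ) = (X t)⁻¹ := by
      rw [Matrix.coe_units_inv, hu.unit_spec]
    refine h2.congr_deriv ?_
    change -(((hu.unit⁻¹ : (Matrix n n ℂ)ˣ) : Matrix n n ℂ) * X' *
      ((hu.unit⁻¹ : (Matrix n n ℂ)ˣ) : Matrix n n ℂ)) = _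
    rw [h4]
  have hinv' : ∀ i j, HasDerivAt (fun s => (X s)⁻¹ i j) ((-((X t)⁻¹ * X' * (X t)⁻¹)) i j) t :=
    fun i j => hasDerivAt_pi.1 (hasDerivAt_pi.1 hinv i) j
  have key : HasDerivAt (fun s => ∑ i, r i * ∑ j, (X s)⁻¹ i j * c s j)
      (∑ i, r i * ∑ j, ((-((X t)⁻¹ * X' * (X t)⁻¹)) i j * c t j + (X t)⁻¹ i j * c' j)) t :=
    HasDerivAt.fun_sum fun i _ => (HasDerivAt.fun_sum fun j _ =>
      (hinv' i j).mul (hc j)).const_mul _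
  refine key.congr_deriv ?_
  rw [sub_eq_neg_add, ← dotProduct_neg, ← neg_mulVec, ← dotProduct_add]
  simp only [dotProduct, mulVec, Pi.add_apply, Finset.sum_add_distrib]

end

theorem contDiff_det {E : Type*} [NormedAddCommGroup E] [NormedSpace ℝ E] {k : ℕ∞}
    {X : E → Matrix n n ℂ} (hX : ∀ i j, ContDiff ℝ k (fun s => X s i j)) :
    ContDiff ℝ k (fun s => (X s).det) := by
  simp only [det_apply]
  exact ContDiff.sum fun τ _ => (contDiff_prod fun i _ => hX _ _).const_smul _

theorem contDiff_dotProduct_inv_mulVec {E : Type*} [NormedAddCommGroup E] [NormedSpace ℝ E]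
    {k : ℕ∞} {X : E → Matrix n n ℂ} {c : E → n → ℂ} (r : n → ℂ)
    (hX : ∀ i j, ContDiff ℝ k (fun s => X s i j))
    (hc : ∀ i, ContDiff ℝ k (fun s => c s i)) (hdet : ∀ s, (X s).det ≠ 0) :
    ContDiff ℝ k (fun s => r ⬝ᵥ (X s)⁻¹ *ᵥ c s) := by
  have hinv : ∀ i j, ContDiff ℝ k (fun s => (X s)⁻¹ i j) := by
    intro i j
    simp only [inv_def, Ring.inverse_eq_inv', Matrix.smul_apply, smul_eq_mul, adjugate_apply]
    refine ((contDiff_det hX).inv hdet).mul (contDiff_det fun a b => ?_)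
    by_cases hab : a = j
    · subst hab
      simp only [updateRow_self]
      exact contDiff_const
    · simp only [updateRow_ne hab]
      exact hX a b
  simp only [dotProduct, mulVec]
  exact ContDiff.sum fun i _ => contDiff_const.mul (ContDiff.sum fun j _ => (hinv i j).mul (hc j))

end MassiveThirring

/-! ### Consequences of the Lyapunov equations -/

namespace MassiveThirring

open Matrix

variable {n : Type*} [Fintype n] [DecidableEq n]

/-- Hermitian matrices `M`, `B` with `P M + M Pᴴ = φ φ†` and `Pᴴ B + B P = σ a a†`. -/
structure Reduction (σ : ℝ) (P M B : Matrix n n ℂ) (a φ : n → ℂ) : Prop where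
  hM : Mᴴ = M
  hB : Bᴴ = B
  lyapM : P * M + M * Pᴴ = vecMulVec φ (star φ)
  lyapB : Pᴴ * B + B * P = (σ : ℂ) • vecMulVec a (star a)

namespace Reduction

variable {σ : ℝ} {P M B : Matrix n n ℂ} {a φ : n → ℂ}

/-- `1 + A B` with `A = i P M`. -/
def F (P M B : Matrix n n ℂ) : Matrix n n ℂ := 1 + (Complex.I • (P * M)) * B

/-- `1 + A' B` with `A' = -i M Pᴴ`. -/
def G (P M B : Matrix n n ℂ) : Matrix n n ℂ := 1 + (-Complex.I • (M * Pᴴ)) * B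

theorem F_eq (h : Reduction σ P M B a φ) :
    F P M B = G P M B + Complex.I • (vecMulVec φ (star φ) * B) := by
  rw [← h.lyapM, F, G]
  simp only [Matrix.add_mul, Matrix.smul_mul, smul_add, neg_smul, Matrix.neg_mul]
  abel

theorem F_mul (h : Reduction σ P M B a φ) :
    F P M B * P = P * G P M B + (Complex.I * σ) • (P * M * vecMulVec a (star a)) := by
  have : (Complex.I * σ) • (P * M * vecMulVec a (star a)) =
      Complex.I • (P * M * ((σ : ℂ) • vecMulVec a (star a))) := by
    rw [Matrix.mul_smul, smul_smul]
  rw [this, ← h.lyapB, F, G]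
  simp only [Matrix.add_mul, Matrix.mul_add, Matrix.smul_mul, Matrix.mul_smul, smul_add, neg_smul,
    Matrix.mul_neg, Matrix.neg_mul, Matrix.mul_assoc, Matrix.one_mul, Matrix.mul_one]
  abel

theorem conjTranspose_F (h : Reduction σ P M B a φ) :
    (F P M B)ᴴ = 1 + (-Complex.I) • (B * M * Pᴴ) := by
  simp [F, conjTranspose_mul, h.hM, h.hB, Matrix.mul_assoc]

theorem conjTranspose_G (h : Reduction σ P M B a φ) :
    (G P M B)ᴴ = 1 + Complex.I • (B * P * M) := by
  simp [G, conjTranspose_mul, h.hM, h.hB, Matrix.mul_assoc]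

/-- F† = 1 - iBMP† is G with its factors cyclically permuted, so Sylvester's identity det(1 + XY) =
det(1 + YX) applies. -/
theorem conj_det_F (h : Reduction σ P M B a φ) : conj (F P M B).det = (G P M B).det := by
  rw [starRingEnd_apply, ← det_conjTranspose, h.conjTranspose_F, G]
  rw [← Matrix.smul_mul, ← Matrix.mul_smul, Matrix.mul_assoc, det_one_add_mul_comm, Matrix.smul_mul]

theorem conjTranspose_G_mul (h : Reduction σ P M B a φ) :
    (G P M B)ᴴ * B = B * F P M B := by
  rw [h.conjTranspose_G, F]
  simp [Matrix.add_mul, Matrix.mul_add, Matrix.mul_assoc]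

theorem conjTranspose_F_mul (h : Reduction σ P M B a φ) :
    (F P M B)ᴴ * B = B * G P M B := by
  rw [h.conjTranspose_F, G]
  simp [Matrix.add_mul, Matrix.mul_add, Matrix.mul_assoc]

/-- Source of the |v|² term. Since BF⁻¹ = (G†)⁻¹B, the left side is (G†)⁻¹(BPG + G†P†B)G⁻¹; the
terms containing M cancel in the middle, leaving the Lyapunov equation for B. -/
theorem mul_inv_F_mul_add (h : Reduction σ P M B a φ) {R S : Matrix n n ℂ}
    (hR : F P M B * R = 1) (hS : G P M B * S = 1) :
    B * R * P + Pᴴ * B * S = (σ : ℂ) • (Sᴴ * vecMulVec a (star a) * S) := by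
  have hSG : Sᴴ * (G P M B)ᴴ = 1 := by rw [← conjTranspose_mul, hS, conjTranspose_one]
  have e : B * R = Sᴴ * B := by
    calc B * R = Sᴴ * ((G P M B)ᴴ * B) * R := by
          rw [← Matrix.mul_assoc Sᴴ, hSG, Matrix.one_mul]
      _ = Sᴴ * B * (F P M B * R) := by rw [h.conjTranspose_G_mul]; simp only [Matrix.mul_assoc]
      _ = Sᴴ * B := by rw [hR, Matrix.mul_one]
  have e2 : B * P * G P M B + (G P M B)ᴴ * (Pᴴ * B) = Pᴴ * B + B * P := by
    rw [h.conjTranspose_G, G]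
    simp only [Matrix.add_mul, Matrix.mul_add, Matrix.smul_mul, Matrix.mul_smul, neg_smul,
      Matrix.mul_neg, Matrix.neg_mul, Matrix.mul_assoc, Matrix.one_mul, Matrix.mul_one]
    abel
  calc B * R * P + Pᴴ * B * S
      = Sᴴ * B * P * (G P M B * S) + Sᴴ * (G P M B)ᴴ * (Pᴴ * B * S) := by
        rw [e, hS, hSG, Matrix.mul_one, Matrix.one_mul]
    _ = Sᴴ * (B * P * G P M B + (G P M B)ᴴ * (Pᴴ * B)) * S := by noncomm_ring
    _ = _ := by rw [e2, h.lyapB, Matrix.mul_smul, Matrix.smul_mul]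

/-- Source of the |u|² term: the counterpart of `mul_inv_F_mul_add` with F and G exchanged and P
replaced by Q = P⁻¹. The terms ±iBMB cancel. -/
theorem mul_inv_G_mul_add (h : Reduction σ P M B a φ) {Q R S : Matrix n n ℂ} (hPQ : P * Q = 1)
    (hQP : Q * P = 1) (hR : F P M B * R = 1) (hS : G P M B * S = 1) :
    B * S * Q + Qᴴ * B * R =
      (σ : ℂ) • (Rᴴ * (Qᴴ * vecMulVec a (star a) * Q) * R) := by
  have hRF : Rᴴ * (F P M B)ᴴ = 1 := by rw [← conjTranspose_mul, hR, conjTranspose_one]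
  have hPQ' : Qᴴ * Pᴴ = 1 := by rw [← conjTranspose_mul, hPQ, conjTranspose_one]
  have hQP' : Pᴴ * Qᴴ = 1 := by rw [← conjTranspose_mul, hQP, conjTranspose_one]
  have e : B * S = Rᴴ * B := by
    calc B * S = Rᴴ * ((F P M B)ᴴ * B) * S := by
          rw [← Matrix.mul_assoc Rᴴ, hRF, Matrix.one_mul]
      _ = Rᴴ * B * (G P M B * S) := by rw [h.conjTranspose_F_mul]; simp only [Matrix.mul_assoc]
      _ = Rᴴ * B := by rw [hS, Matrix.mul_one]
  have e1 : B * Q + Qᴴ * B = (σ : ℂ) • (Qᴴ * vecMulVec a (star a) * Q) := by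
    rw [← Matrix.smul_mul, ← Matrix.mul_smul, ← h.lyapB]
    calc B * Q + Qᴴ * B = (Qᴴ * Pᴴ) * B * Q + Qᴴ * B * (P * Q) := by
          rw [hPQ, hPQ', Matrix.one_mul, Matrix.mul_one]
      _ = _ := by noncomm_ring
  have e2 : B * Q * F P M B + (F P M B)ᴴ * (Qᴴ * B) = B * Q + Qᴴ * B := by
    have h1 : B * Q * F P M B = B * Q + Complex.I • (B * M * B) := by
      rw [F, Matrix.mul_add, Matrix.mul_one, Matrix.smul_mul, Matrix.mul_smul]
      congr 2
      calc B * Q * (P * M * B) = B * (Q * P) * M * B := by noncomm_ring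
        _ = _ := by rw [hQP, Matrix.mul_one]
    have h2 : (F P M B)ᴴ * (Qᴴ * B) = Qᴴ * B - Complex.I • (B * M * B) := by
      rw [h.conjTranspose_F, Matrix.add_mul, Matrix.one_mul, neg_smul, Matrix.neg_mul,
        Matrix.smul_mul, ← sub_eq_add_neg]
      congr 2
      calc B * M * Pᴴ * (Qᴴ * B) = B * M * (Pᴴ * Qᴴ) * B := by noncomm_ring
        _ = _ := by rw [hQP', Matrix.mul_one]
    rw [h1, h2]
    abel
  calc B * S * Q + Qᴴ * B * R
      = Rᴴ * B * Q * (F P M B * R) + Rᴴ * (F P M B)ᴴ * (Qᴴ * B * R) := by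
        rw [e, hR, hRF, Matrix.mul_one, Matrix.one_mul]
    _ = Rᴴ * (B * Q * F P M B + (F P M B)ᴴ * (Qᴴ * B)) * R := by noncomm_ring
    _ = _ := by rw [e2, e1, Matrix.mul_smul, Matrix.smul_mul]

theorem det_F_eq (h : Reduction σ P M B a φ) (hG : (G P M B).det ≠ 0) :
    (F P M B).det = (G P M B).det * (1 + Complex.I * (star φ ⬝ᵥ (B * (G P M B)⁻¹) *ᵥ φ)) := by
  have e : F P M B = (1 + Complex.I • (1 * vecMulVec φ (star φ)) * (B * (G P M B)⁻¹)) * G P M B := by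
    rw [Matrix.add_mul, Matrix.mul_assoc, Matrix.mul_assoc B, nonsing_inv_mul _ hG.isUnit, h.F_eq]
    simp
  rw [e, det_mul, Matrix.smul_mul, Matrix.one_mul, ← Matrix.mul_smul, det_one_add_mul_comm,
    Matrix.smul_mul, det_one_add_smul_mul_vecMulVec, mul_comm]

theorem det_F_eq' (h : Reduction σ P M B a φ) {Q : Matrix n n ℂ}
    (hQP : Q * P = 1) (hG : (G P M B).det ≠ 0) :
    (F P M B).det = (G P M B).det *
      (1 + Complex.I * σ * (star a ⬝ᵥ ((G P M B)⁻¹ * M) *ᵥ a)) := by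
  -- Conjugation by P leaves det F unchanged and turns the rank-one relation for FP - PG into a
  -- rank-one update of G.
  have e : Q * F P M B * P =
      G P M B * (1 + (Complex.I * σ) • ((G P M B)⁻¹ * M * vecMulVec a (star a))) := by
    rw [Matrix.mul_assoc, h.F_mul, Matrix.mul_add, Matrix.mul_add, Matrix.mul_smul, Matrix.mul_smul]
    simp only [← Matrix.mul_assoc]
    rw [hQP, mul_nonsing_inv _ hG.isUnit]
    simp
  have e' := congrArg det e
  rw [det_mul, det_mul, det_mul, det_one_add_smul_mul_vecMulVec] at e'
  have hd : Q.det * P.det = 1 := by rw [← det_mul, hQP, det_one]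
  linear_combination e' - (F P M B).det * hd

/-- Resolvent identity for the rank-one difference F - G. Here F⁻¹ stands to the left of φφ†;
`dotProduct_inv_G` has the two inverses in the other order. -/
theorem dotProduct_inv_F (h : Reduction σ P M B a φ) (hF : (F P M B).det ≠ 0)
    (hG : (G P M B).det ≠ 0) (r c : n → ℂ) :
    r ⬝ᵥ (G P M B)⁻¹ *ᵥ c = r ⬝ᵥ (F P M B)⁻¹ *ᵥ c +
      Complex.I * (r ⬝ᵥ (F P M B)⁻¹ *ᵥ φ) * (star φ ⬝ᵥ (B * (G P M B)⁻¹) *ᵥ c) := by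
  have e : (G P M B)⁻¹ = (F P M B)⁻¹ +
      Complex.I • ((F P M B)⁻¹ * vecMulVec φ (star φ) * (B * (G P M B)⁻¹)) := by
    calc (G P M B)⁻¹ = (F P M B)⁻¹ * F P M B * (G P M B)⁻¹ := by
          rw [nonsing_inv_mul _ hF.isUnit, Matrix.one_mul]
      _ = (F P M B)⁻¹ * (G P M B * (G P M B)⁻¹) +
          Complex.I • ((F P M B)⁻¹ * vecMulVec φ (star φ) * (B * (G P M B)⁻¹)) := by
          conv_lhs => enter [1, 2]; rw [h.F_eq]
          simp only [Matrix.mul_add, Matrix.add_mul, Matrix.mul_assoc, Matrix.smul_mul,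
            Matrix.mul_smul]
      _ = _ := by rw [mul_nonsing_inv _ hG.isUnit, Matrix.mul_one]
  conv_lhs => rw [e]
  rw [add_mulVec, smul_mulVec, dotProduct_add, dotProduct_smul,
    dotProduct_mul_vecMulVec_mul_mulVec, smul_eq_mul]
  ring

theorem dotProduct_inv_G (h : Reduction σ P M B a φ) (hF : (F P M B).det ≠ 0)
    (hG : (G P M B).det ≠ 0) (r c : n → ℂ) :
    r ⬝ᵥ (G P M B)⁻¹ *ᵥ c = r ⬝ᵥ (F P M B)⁻¹ *ᵥ c +
      Complex.I * (r ⬝ᵥ (G P M B)⁻¹ *ᵥ φ) * (star φ ⬝ᵥ (B * (F P M B)⁻¹) *ᵥ c) := by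
  have e : (G P M B)⁻¹ = (F P M B)⁻¹ +
      Complex.I • ((G P M B)⁻¹ * vecMulVec φ (star φ) * (B * (F P M B)⁻¹)) := by
    calc (G P M B)⁻¹ = (G P M B)⁻¹ * (F P M B * (F P M B)⁻¹) := by
          rw [mul_nonsing_inv _ hF.isUnit, Matrix.mul_one]
      _ = (G P M B)⁻¹ * G P M B * (F P M B)⁻¹ +
          Complex.I • ((G P M B)⁻¹ * vecMulVec φ (star φ) * (B * (F P M B)⁻¹)) := by
          conv_lhs => enter [2, 1]; rw [h.F_eq]
          simp only [Matrix.mul_add, Matrix.add_mul, Matrix.mul_assoc, Matrix.smul_mul,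
            Matrix.mul_smul]
      _ = _ := by rw [nonsing_inv_mul _ hG.isUnit, Matrix.one_mul]
  conv_lhs => rw [e]
  rw [add_mulVec, smul_mulVec, dotProduct_add, dotProduct_smul,
    dotProduct_mul_vecMulVec_mul_mulVec, smul_eq_mul]
  ring

/-- Resolvent identity for the other rank-one relation, QF - GQ = iσMaa†Q. -/
theorem dotProduct_inv_G_mul (h : Reduction σ P M B a φ) {Q : Matrix n n ℂ} (hPQ : P * Q = 1)
    (hQP : Q * P = 1) (hF : (F P M B).det ≠ 0) (hG : (G P M B).det ≠ 0) (r c : n → ℂ) :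
    r ⬝ᵥ ((G P M B)⁻¹ * Q) *ᵥ c = r ⬝ᵥ (Q * (F P M B)⁻¹) *ᵥ c +
      Complex.I * σ * (r ⬝ᵥ ((G P M B)⁻¹ * M) *ᵥ a) * (star a ⬝ᵥ (Q * (F P M B)⁻¹) *ᵥ c) := by
  have e0 : Q * F P M B = G P M B * Q + (Complex.I * σ) • (M * vecMulVec a (star a) * Q) := by
    calc Q * F P M B = Q * (F P M B * P) * Q := by
          rw [Matrix.mul_assoc Q, Matrix.mul_assoc _ P, hPQ, Matrix.mul_one]
      _ = (Q * P) * G P M B * Q + (Complex.I * σ) • ((Q * P) * (M * vecMulVec a (star a) * Q)) := by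
          rw [h.F_mul]
          simp only [Matrix.mul_add, Matrix.add_mul, Matrix.mul_assoc, Matrix.smul_mul,
            Matrix.mul_smul]
      _ = _ := by rw [hQP, Matrix.one_mul, Matrix.one_mul]
  have e : (G P M B)⁻¹ * Q = Q * (F P M B)⁻¹ + (Complex.I * σ) •
      ((G P M B)⁻¹ * M * vecMulVec a (star a) * (Q * (F P M B)⁻¹)) := by
    calc (G P M B)⁻¹ * Q = (G P M B)⁻¹ * (Q * F P M B) * (F P M B)⁻¹ := by
          rw [Matrix.mul_assoc, Matrix.mul_assoc, mul_nonsing_inv _ hF.isUnit, Matrix.mul_one]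
      _ = (G P M B)⁻¹ * G P M B * (Q * (F P M B)⁻¹) + (Complex.I * σ) •
          ((G P M B)⁻¹ * M * vecMulVec a (star a) * (Q * (F P M B)⁻¹)) := by
          rw [e0]
          simp only [Matrix.mul_add, Matrix.add_mul, Matrix.mul_assoc, Matrix.smul_mul,
            Matrix.mul_smul]
      _ = _ := by rw [nonsing_inv_mul _ hG.isUnit, Matrix.one_mul]
  rw [e, add_mulVec, smul_mulVec, dotProduct_add, dotProduct_smul,
    dotProduct_mul_vecMulVec_mul_mulVec, smul_eq_mul]
  ring

end Reduction

end MassiveThirring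

/-! ### Nonvanishing of det F and the algebraic form of the field equations -/

namespace MassiveThirring

open Matrix

theorem vecMul_dotProduct_mulVec {n : Type*} [Fintype n] (r c : n → ℂ) (X Y : Matrix n n ℂ) :
    (r ᵥ* X) ⬝ᵥ Y *ᵥ c = r ⬝ᵥ (X * Y) *ᵥ c := by
  rw [← dotProduct_mulVec, mulVec_mulVec]

namespace Reduction

variable {n : Type*} [Fintype n]
variable {σ : ℝ} {P M B : Matrix n n ℂ} {a φ : n → ℂ}

-- The form is semidefinite up to the sign of `s`, so its isotropic vectors lie in its kernel.
open scoped ComplexOrder in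
theorem mulVec_eq_zero_of_dotProduct_eq_zero {d c : n → ℂ} {s : ℝ} {X : Matrix n n ℂ}
    (hX : X = (s : ℂ) • vecMulVec d (star d)) (h : star c ⬝ᵥ X *ᵥ c = 0) : X *ᵥ c = 0 := by
  by_cases hs : s = 0
  · simp [hX, hs]
  · rw [hX, smul_mulVec, dotProduct_smul, smul_eq_zero_iff_right (by exact_mod_cast hs),
      (posSemidef_vecMulVec_self_star d).dotProduct_mulVec_zero_iff] at h
    rw [hX, smul_mulVec, h, smul_zero]

theorem ker_invariant (h : Reduction σ P M B a φ) {z : n → ℂ}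
    (hz : z = -Complex.I • (B *ᵥ (P *ᵥ (M *ᵥ z)))) :
    Pᴴ *ᵥ z = -Complex.I • (B *ᵥ (P *ᵥ (M *ᵥ (Pᴴ *ᵥ z)))) ∧
      M *ᵥ (Pᴴ *ᵥ z) = -(P *ᵥ (M *ᵥ z)) := by
  have self_conj : ∀ (c : n → ℂ) (X : Matrix n n ℂ), Xᴴ = X →
      conj (star c ⬝ᵥ X *ᵥ c) = star c ⬝ᵥ X *ᵥ c := by
    intro c X hX
    rw [star_dotProduct_mulVec, hX]
  have conj_dot : ∀ c d : n → ℂ, conj (star c ⬝ᵥ d) = star d ⬝ᵥ c := by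
    intro c d
    rw [starRingEnd_apply, star_dotProduct, star_star]
  set y := P *ᵥ (M *ᵥ z) with hy
  have hBy : B *ᵥ y = Complex.I • z := by
    conv_rhs => rw [hz]
    rw [smul_smul]
    simp
  have h1 : M *ᵥ (Pᴴ *ᵥ z) = -y := by
    -- As B is Hermitian, z†PMz is purely imaginary; adding its conjugate gives |φ†z|² = 0.
    have e1 : star z ⬝ᵥ (P * M) *ᵥ z = Complex.I * (star y ⬝ᵥ B *ᵥ y) := by
      rw [← mulVec_mulVec, ← hy, ← conj_dot, ← self_conj y B h.hB, hBy, dotProduct_smul, smul_eq_mul,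
        map_mul, Complex.conj_I]
      linear_combination conj (star y ⬝ᵥ z) * Complex.I_sq
    have e2 : star z ⬝ᵥ (M * Pᴴ) *ᵥ z = conj (star z ⬝ᵥ (P * M) *ᵥ z) := by
      rw [star_dotProduct_mulVec, conjTranspose_mul, h.hM]
    have e3 : star z ⬝ᵥ (P * M + M * Pᴴ) *ᵥ z = 0 := by
      rw [add_mulVec, dotProduct_add, e2, e1, map_mul, self_conj y B h.hB, Complex.conj_I]
      ring
    have e4 := mulVec_eq_zero_of_dotProduct_eq_zero (s := 1) (d := φ) (by rw [h.lyapM]; simp) e3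
    rw [add_mulVec, ← mulVec_mulVec, ← mulVec_mulVec, ← hy] at e4
    exact eq_neg_of_add_eq_zero_right e4
  refine ⟨?_, h1⟩
  have h2 : (Pᴴ * B + B * P) *ᵥ y = 0 := by
    -- The same argument for B: with w = P†z and Mw = -y, the number y†BPy = i w†Mw is purely
    -- imaginary.
    have e0 : star z ⬝ᵥ P *ᵥ y = -(star (Pᴴ *ᵥ z) ⬝ᵥ M *ᵥ (Pᴴ *ᵥ z)) := by
      rw [h1, dotProduct_neg, neg_neg, star_mulVec, conjTranspose_conjTranspose, dotProduct_mulVec]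
    have e1 : star y ⬝ᵥ (B * P) *ᵥ y =
        Complex.I * (star (Pᴴ *ᵥ z) ⬝ᵥ M *ᵥ (Pᴴ *ᵥ z)) := by
      rw [← mulVec_mulVec, dotProduct_mulVec, ← h.hB, ← star_mulVec, hBy, star_smul, smul_dotProduct,
        e0]
      simp
    have e2 : star y ⬝ᵥ (Pᴴ * B) *ᵥ y = conj (star y ⬝ᵥ (B * P) *ᵥ y) := by
      rw [star_dotProduct_mulVec, conjTranspose_mul, h.hB]
    refine mulVec_eq_zero_of_dotProduct_eq_zero h.lyapB ?_
    rw [add_mulVec, dotProduct_add, e2, e1, map_mul, self_conj _ M h.hM, Complex.conj_I]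
    ring
  rw [add_mulVec, ← mulVec_mulVec, ← mulVec_mulVec, hBy, mulVec_smul] at h2
  rw [h1, mulVec_neg, mulVec_neg, ← eq_neg_of_add_eq_zero_left h2, smul_smul]
  simp

variable [DecidableEq n]

/-- κ = f/f* is unimodular because its denominator is the conjugate of its numerator. Each rank-one
relation yields one formula for it. -/
theorem exists_ratio (h : Reduction σ P M B a φ) {Q : Matrix n n ℂ}
    (hQP : Q * P = 1) (hF : (F P M B).det ≠ 0) (hG : (G P M B).det ≠ 0) :
    ∃ κ : ℂ, (F P M B).det = (G P M B).det * κ ∧ κ * conj κ = 1 ∧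
      κ = 1 + Complex.I * (star φ ⬝ᵥ (B * (G P M B)⁻¹) *ᵥ φ) ∧
      κ = 1 + Complex.I * σ * (star a ⬝ᵥ ((G P M B)⁻¹ * M) *ᵥ a) := by
  have d1 := h.det_F_eq hG
  have d2 := h.det_F_eq' hQP hG
  refine ⟨_, d1, ?_, rfl, mul_left_cancel₀ hG (d1.symm.trans d2)⟩
  generalize 1 + Complex.I * (star φ ⬝ᵥ (B * (G P M B)⁻¹) *ᵥ φ) = κ at d1
  have d3 := congrArg conj d1
  rw [map_mul, ← h.conj_det_F, Complex.conj_conj, h.conj_det_F] at d3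
  refine mul_left_cancel₀ hF ?_
  linear_combination -κ * d3 - d1

/-- Algebraic form of `i u_x + v + σ u |v|² = 0`. -/
theorem eq_u (h : Reduction σ P M B a φ) {Q : Matrix n n ℂ} (hPQ : P * Q = 1)
    (hQP : Q * P = 1) (hF : (F P M B).det ≠ 0) (hG : (G P M B).det ≠ 0) {u v : ℂ}
    (hu : u = Complex.I * (star a ⬝ᵥ (Q * (G P M B)⁻¹) *ᵥ φ))
    (hv : v = star a ⬝ᵥ (F P M B)⁻¹ *ᵥ φ) :
    star a ⬝ᵥ (Q * (G P M B)⁻¹ * P) *ᵥ φ + u * (star φ ⬝ᵥ (Pᴴ * B * (G P M B)⁻¹) *ᵥ φ) =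
      v + σ * u * (v * conj v) := by
  obtain ⟨κ, -, hκn, hκ, hκ'⟩ := h.exists_ratio hQP hF hG
  have h2 := congrArg (fun X => star φ ⬝ᵥ X *ᵥ φ)
    (h.mul_inv_F_mul_add (mul_nonsing_inv _ hF.isUnit) (mul_nonsing_inv _ hG.isUnit))
  simp only [add_mulVec, smul_mulVec, dotProduct_add, dotProduct_smul,
    dotProduct_mul_vecMulVec_mul_mulVec, smul_eq_mul, ← star_dotProduct_mulVec] at h2
  have hκ0 : κ ≠ 0 := left_ne_zero_of_mul_eq_one hκn
  have k1 : star a ⬝ᵥ (G P M B)⁻¹ *ᵥ φ = v * κ := by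
    linear_combination h.dotProduct_inv_F hF hG (star a) φ - v * hκ -
      (1 + Complex.I * (star φ ⬝ᵥ (B * (G P M B)⁻¹) *ᵥ φ)) * hv
  have k2 := h.dotProduct_inv_G hF hG (star a ᵥ* Q) (P *ᵥ φ)
  have k3 := h.dotProduct_inv_G_mul hPQ hQP hF hG (star a) (P *ᵥ φ)
  simp only [mulVec_mulVec, vecMul_dotProduct_mulVec] at k2 k3
  rw [← Matrix.mul_assoc, ← Matrix.mul_assoc] at k2
  rw [Matrix.mul_assoc _ Q P, hQP, Matrix.mul_one] at k3
  -- By `k1` and `k3`, a†G⁻¹φ equals κ times each side.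
  have k4 : star a ⬝ᵥ (Q * (F P M B)⁻¹ * P) *ᵥ φ = v := by
    refine mul_right_cancel₀ hκ0 ?_
    linear_combination k1 - k3 + (star a ⬝ᵥ (Q * (F P M B)⁻¹ * P) *ᵥ φ) * hκ'
  rw [k1, map_mul] at h2
  rw [k2, k4]
  linear_combination u * h2 + σ * u * v * conj v * hκn -
    (star φ ⬝ᵥ (B * (F P M B)⁻¹ * P) *ᵥ φ) * hu

/-- Algebraic form of `i v_t + u + σ v |u|² = 0`. -/
theorem eq_v (h : Reduction σ P M B a φ) {Q : Matrix n n ℂ} (hPQ : P * Q = 1)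
    (hQP : Q * P = 1) (hF : (F P M B).det ≠ 0) (hG : (G P M B).det ≠ 0) {u v : ℂ}
    (hu : u = Complex.I * (star a ⬝ᵥ (Q * (G P M B)⁻¹) *ᵥ φ))
    (hv : v = star a ⬝ᵥ (F P M B)⁻¹ *ᵥ φ) :
    Complex.I * (star a ⬝ᵥ ((F P M B)⁻¹ * Q) *ᵥ φ) +
      v * (star φ ⬝ᵥ (Qᴴ * B * (F P M B)⁻¹) *ᵥ φ) = u + σ * v * (u * conj u) := by
  obtain ⟨κ, -, hκn, hκ, hκ'⟩ := h.exists_ratio hQP hF hG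
  have h2 := congrArg (fun X => star φ ⬝ᵥ X *ᵥ φ)
    (h.mul_inv_G_mul_add hPQ hQP (mul_nonsing_inv _ hF.isUnit) (mul_nonsing_inv _ hG.isUnit))
  have e : (F P M B)⁻¹ᴴ * (Qᴴ * vecMulVec a (star a) * Q) * (F P M B)⁻¹ =
      (Q * (F P M B)⁻¹)ᴴ * vecMulVec a (star a) * (Q * (F P M B)⁻¹) := by
    simp only [conjTranspose_mul, Matrix.mul_assoc]
  simp only [e, add_mulVec, smul_mulVec, dotProduct_add, dotProduct_smul,
    dotProduct_mul_vecMulVec_mul_mulVec, smul_eq_mul, ← star_dotProduct_mulVec] at h2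
  have k1 := h.dotProduct_inv_F hF hG (star a) (Q *ᵥ φ)
  have k2 := h.dotProduct_inv_F hF hG (star a ᵥ* Q) φ
  have k3 := h.dotProduct_inv_G_mul hPQ hQP hF hG (star a) φ
  simp only [mulVec_mulVec, vecMul_dotProduct_mulVec] at k1 k2
  rw [← hv] at k1
  have hu' : u = Complex.I * κ * (star a ⬝ᵥ (Q * (F P M B)⁻¹) *ᵥ φ) := by
    linear_combination hu + Complex.I * k2 -
      Complex.I * (star a ⬝ᵥ (Q * (F P M B)⁻¹) *ᵥ φ) * hκ
  generalize star a ⬝ᵥ (Q * (F P M B)⁻¹) *ᵥ φ = z at *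
  -- u = iκz, and |κ| = 1.
  have huu : u * conj u = z * conj z := by
    rw [hu', map_mul, map_mul, Complex.conj_I]
    linear_combination (-Complex.I ^ 2) * z * conj z * hκn - z * conj z * Complex.I_sq
  rw [huu]
  have hI := Complex.I_sq
  linear_combination v * h2 - Complex.I * k1 + Complex.I * k3 - hu' - Complex.I * z * hκ' -
    v * (star φ ⬝ᵥ (B * (G P M B)⁻¹ * Q) *ᵥ φ) * hI

/-- `1 + A B` is invertible when `P` is diagonal with `p_i + p_j^* ≠ 0`. -/
theorem det_F_ne_zero {p : n → ℂ} (h : Reduction σ (diagonal p) M B a φ)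
    (hpp : ∀ i j, p i + conj (p j) ≠ 0) : (F (diagonal p) M B).det ≠ 0 := by
  intro h0
  -- Sylvester's identity passes to the cyclic form whose kernel `ker_invariant` describes.
  have h0' : (1 + Complex.I • (B * diagonal p * M)).det = 0 := by
    rw [← h0, F, det_one_add_mul_comm, Matrix.mul_smul, Matrix.mul_assoc]
  obtain ⟨z, hz0, hz⟩ := exists_mulVec_eq_zero_iff.2 h0'
  have hz1 : z = -Complex.I • (B *ᵥ (diagonal p *ᵥ (M *ᵥ z))) := by
    rw [add_mulVec, one_mulVec, smul_mulVec, ← mulVec_mulVec, ← mulVec_mulVec] at hz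
    rw [neg_smul]
    exact eq_neg_of_add_eq_zero_left hz
  -- Here y = ∏_{j∈s} (P† - p_j^*) z stays in the kernel, and M carries the product to ∏_{j∈s} (-P -
  -- p_j^*). Over all j the first product is zero, while the second is invertible.
  have key : ∀ s : Finset n, ∃ y : n → ℂ,
      (∀ i, y i = (∏ j ∈ s, (conj (p i) - conj (p j))) * z i) ∧
      (y = -Complex.I • (B *ᵥ (diagonal p *ᵥ (M *ᵥ y)))) ∧
      ∀ i, (M *ᵥ y) i = (∏ j ∈ s, (-p i - conj (p j))) * (M *ᵥ z) i := by
    intro s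
    induction s using Finset.induction_on with
    | empty => exact ⟨z, by simp, hz1, by simp⟩
    | insert k s hk ih =>
      obtain ⟨y, hy1, hy2, hy3⟩ := ih
      obtain ⟨i1, i2⟩ := h.ker_invariant hy2
      refine ⟨(diagonal p)ᴴ *ᵥ y - conj (p k) • y, fun i => ?_, ?_, fun i => ?_⟩
      · rw [Finset.prod_insert hk, Pi.sub_apply, Pi.smul_apply, hy1, diagonal_conjTranspose,
          mulVec_diagonal, hy1]
        simp only [Pi.star_apply, smul_eq_mul, starRingEnd_apply]
        ring
      · simp only [mulVec_sub, smul_sub, mulVec_smul]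
        rw [← i1, smul_comm, ← hy2]
      · rw [Finset.prod_insert hk, mulVec_sub, i2, mulVec_smul, Pi.sub_apply, Pi.neg_apply,
          Pi.smul_apply, mulVec_diagonal, hy3, smul_eq_mul]
        ring
  obtain ⟨y, hy1, -, hy3⟩ := key Finset.univ
  have hy : y = 0 := by
    ext i
    rw [hy1, Finset.prod_eq_zero (Finset.mem_univ i) (sub_self _), zero_mul, Pi.zero_apply]
  have hMz : M *ᵥ z = 0 := by
    ext i
    have := hy3 i
    rw [hy, mulVec_zero, Pi.zero_apply, eq_comm, mul_eq_zero, Finset.prod_eq_zero_iff] at this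
    refine this.resolve_left ?_
    rintro ⟨j, -, hj⟩
    exact hpp i j (by linear_combination -hj)
  exact hz0 (by rw [hz1, hMz]; simp)

end Reduction

end MassiveThirring

/-! ### The soliton matrices as an instance of `Reduction` -/

namespace MassiveThirring

open Matrix

variable {N : ℕ}

theorem star_apply_eq_conj {n : Type*} (v : n → ℂ) (i : n) : star v i = conj (v i) := rfl

/-- The Hermitian matrix `M` with `A = i P M` and `A' = -i M Pᴴ`. -/
noncomputable def matM (p ξ₀ : Fin N → ℂ) (x t : ℝ) : Matrix (Fin N) (Fin N) ℂ :=
  Matrix.of fun i j =>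
    Complex.exp (xi p ξ₀ x t i + conj (xi p ξ₀ x t j)) / (p i + conj (p j))

theorem reduction (σ : ℝ) (p α ξ₀ : Fin N → ℂ) (hpp : ∀ i j, p i + conj (p j) ≠ 0) (x t : ℝ) :
    Reduction σ (diagonal p) (matM p ξ₀ x t) (matB σ p α) α (Phi p ξ₀ x t) where
  hM := by
    ext i j
    simp only [conjTranspose_apply, matM, of_apply, ← starRingEnd_apply, map_div₀, map_add,
      ← Complex.exp_conj, Complex.conj_conj]
    rw [add_comm (conj (xi p ξ₀ x t j)), add_comm (conj (p j))]
  hB := by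
    ext i j
    simp only [conjTranspose_apply, matB, of_apply, ← starRingEnd_apply, map_div₀, map_add, map_mul,
      Complex.conj_conj, Complex.conj_ofReal]
    rw [add_comm (p j), mul_right_comm]
  lyapM := by
    ext i j
    have := hpp i j
    simp only [Matrix.add_apply, diagonal_conjTranspose, diagonal_mul, mul_diagonal, matM, of_apply,
      vecMulVec_apply, Phi, star_apply_eq_conj, Complex.exp_add, ← Complex.exp_conj]
    field_simp
  lyapB := by
    ext i j
    have := hpp j i
    rw [add_comm] at this
    simp only [Matrix.add_apply, diagonal_conjTranspose, diagonal_mul, mul_diagonal, matB, of_apply,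
      vecMulVec_apply, star_apply_eq_conj, Matrix.smul_apply, smul_eq_mul]
    field_simp

theorem matA_eq (p ξ₀ : Fin N → ℂ) (x t : ℝ) :
    matA p ξ₀ x t = Complex.I • (diagonal p * matM p ξ₀ x t) := by
  ext i j
  simp only [matA, matM, of_apply, Matrix.smul_apply, diagonal_mul, smul_eq_mul]
  ring

theorem matA'_eq (p ξ₀ : Fin N → ℂ) (x t : ℝ) :
    matA' p ξ₀ x t = -Complex.I • (matM p ξ₀ x t * (diagonal p)ᴴ) := by
  ext i j
  simp only [matA', matM, of_apply, Matrix.smul_apply, diagonal_conjTranspose, mul_diagonal,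
    smul_eq_mul, star_apply_eq_conj]
  ring

theorem tauF_eq (σ : ℝ) (p α ξ₀ : Fin N → ℂ) (x t : ℝ) :
    tauF σ p α ξ₀ x t =
      (Reduction.F (diagonal p) (matM p ξ₀ x t) (matB σ p α)).det := by
  rw [tauF, blockDet, det_fromBlocks_one_neg_one, matA_eq, Reduction.F]

theorem tauFStar_eq (σ : ℝ) (p α ξ₀ : Fin N → ℂ) (x t : ℝ) :
    tauFStar σ p α ξ₀ x t =
      (Reduction.G (diagonal p) (matM p ξ₀ x t) (matB σ p α)).det := by
  rw [tauFStar, blockDet, det_fromBlocks_one_neg_one, matA'_eq, Reduction.G]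

theorem det_F_ne_zero (σ : ℝ) (p α ξ₀ : Fin N → ℂ) (hpp : ∀ i j, p i + conj (p j) ≠ 0) (x t : ℝ) :
    (Reduction.F (diagonal p) (matM p ξ₀ x t) (matB σ p α)).det ≠ 0 :=
  (reduction σ p α ξ₀ hpp x t).det_F_ne_zero hpp

theorem det_G_ne_zero (σ : ℝ) (p α ξ₀ : Fin N → ℂ) (hpp : ∀ i j, p i + conj (p j) ≠ 0) (x t : ℝ) :
    (Reduction.G (diagonal p) (matM p ξ₀ x t) (matB σ p α)).det ≠ 0 := by
  rw [← (reduction σ p α ξ₀ hpp x t).conj_det_F]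
  exact (map_ne_zero _).2 (det_F_ne_zero σ p α ξ₀ hpp x t)

theorem borderedDet_matA' (σ : ℝ) (p α ξ₀ : Fin N → ℂ) (hpp : ∀ i j, p i + conj (p j) ≠ 0)
    (x t : ℝ) (r : Fin N → ℂ) :
    borderedDet (matA' p ξ₀ x t) (matB σ p α) (Phi p ξ₀ x t) r =
      -((Reduction.G (diagonal p) (matM p ξ₀ x t) (matB σ p α)).det *
        (r ⬝ᵥ (Reduction.G (diagonal p) (matM p ξ₀ x t) (matB σ p α))⁻¹ *ᵥ Phi p ξ₀ x t)) := by
  have h := det_G_ne_zero σ p α ξ₀ hpp x t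
  rw [Reduction.G, ← matA'_eq] at h ⊢
  rw [borderedDet, det_bordered _ _ _ _ h]

theorem tauG_div_tauFStar (σ : ℝ) (p α ξ₀ : Fin N → ℂ) (hpp : ∀ i j, p i + conj (p j) ≠ 0)
    (x t : ℝ) :
    tauG σ p α ξ₀ x t / tauFStar σ p α ξ₀ x t =
      Complex.I * ((star α ᵥ* diagonal p⁻¹) ⬝ᵥ
        (Reduction.G (diagonal p) (matM p ξ₀ x t) (matB σ p α))⁻¹ *ᵥ Phi p ξ₀ x t) := by
  have hr : (fun j => conj (α j) / p j) = star α ᵥ* diagonal p⁻¹ := by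
    ext j
    rw [vecMul_diagonal, Pi.inv_apply, star_apply_eq_conj, div_eq_mul_inv]
  rw [div_eq_iff (by rw [tauFStar_eq]; exact det_G_ne_zero σ p α ξ₀ hpp x t), tauFStar_eq, tauG,
    borderedDet_matA' σ p α ξ₀ hpp, hr]
  ring

theorem diagonal_mul_diagonal_inv {p : Fin N → ℂ} (hp : ∀ i, p i ≠ 0) :
    diagonal p * diagonal p⁻¹ = 1 := by
  rw [diagonal_mul_diagonal, ← diagonal_one]
  congr 1
  ext i
  exact mul_inv_cancel₀ (hp i)

theorem diagonal_inv_mul_diagonal {p : Fin N → ℂ} (hp : ∀ i, p i ≠ 0) :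
    diagonal p⁻¹ * diagonal p = 1 :=
  mul_eq_one_comm.1 (diagonal_mul_diagonal_inv hp)

/-- The numerator is built on A' and the denominator on A: h = f* · a†G⁻¹φ, and a†G⁻¹φ = κ a†F⁻¹φ
with κ = f/f*, so the quotient involves F⁻¹ alone. -/
theorem tauH_div_tauF (σ : ℝ) (p α ξ₀ : Fin N → ℂ) (hpp : ∀ i j, p i + conj (p j) ≠ 0)
    (x t : ℝ) :
    tauH σ p α ξ₀ x t / tauF σ p α ξ₀ x t =
      star α ⬝ᵥ (Reduction.F (diagonal p) (matM p ξ₀ x t) (matB σ p α))⁻¹ *ᵥ Phi p ξ₀ x t := by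
  have hF := det_F_ne_zero σ p α ξ₀ hpp x t
  have hG := det_G_ne_zero σ p α ξ₀ hpp x t
  have h := reduction σ p α ξ₀ hpp x t
  have hr : (fun j => -conj (α j)) = -star α := rfl
  rw [div_eq_iff (by rw [tauF_eq]; exact hF), tauF_eq, tauH, borderedDet_matA' σ p α ξ₀ hpp, hr,
    neg_dotProduct, h.dotProduct_inv_F hF hG, h.det_F_eq hG]
  ring

/-! ### Derivatives, smoothness and the massive Thirring equations -/

theorem hasDerivAt_matM_x (p ξ₀ : Fin N → ℂ) (hpp : ∀ i j, p i + conj (p j) ≠ 0) (x t : ℝ)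
    (i j : Fin N) :
    HasDerivAt (fun y => matM p ξ₀ y t i j)
      (vecMulVec (Phi p ξ₀ x t) (star (Phi p ξ₀ x t)) i j) x := by
  have h0 : HasDerivAt (fun y : ℝ => (y : ℂ)) 1 x := Complex.ofRealCLM.hasDerivAt
  have h1 := ((((h0.const_mul (p i)).sub_const (1 / p i * (t : ℂ))).add_const (ξ₀ i)).add
    (((h0.const_mul (conj (p j))).sub_const (1 / conj (p j) * (t : ℂ))).add_const
      (conj (ξ₀ j)))).cexp.div_const (p i + conj (p j))
  have := hpp i j
  simp only [matM, of_apply, vecMulVec_apply, Phi, star_apply_eq_conj,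
    ← Complex.exp_conj, xi, map_add, map_sub, map_mul, map_div₀, map_one, Complex.conj_ofReal]
  refine h1.congr_deriv ?_
  simp only [Pi.add_apply, Complex.exp_add]
  field_simp

theorem hasDerivAt_matM_t (p ξ₀ : Fin N → ℂ) (hp : ∀ i, p i ≠ 0)
    (hpp : ∀ i j, p i + conj (p j) ≠ 0) (x t : ℝ) (i j : Fin N) :
    HasDerivAt (fun s => matM p ξ₀ x s i j)
      ((-(diagonal p⁻¹ * vecMulVec (Phi p ξ₀ x t) (star (Phi p ξ₀ x t)) *
        (diagonal p⁻¹)ᴴ) : Matrix (Fin N) (Fin N) ℂ) i j) t := by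
  have h0 : HasDerivAt (fun y : ℝ => (y : ℂ)) 1 t := Complex.ofRealCLM.hasDerivAt
  have h1 := ((((h0.const_mul (1 / p i)).const_sub (p i * (x : ℂ))).add_const (ξ₀ i)).add
    (((h0.const_mul (1 / conj (p j))).const_sub (conj (p j) * (x : ℂ))).add_const
      (conj (ξ₀ j)))).cexp.div_const (p i + conj (p j))
  have := hpp i j
  have := hp i
  have : conj (p j) ≠ 0 := (map_ne_zero _).2 (hp j)
  simp only [matM, of_apply, vecMulVec_apply, Phi, star_apply_eq_conj,
    ← Complex.exp_conj, xi, map_add, map_sub, map_mul, map_div₀, map_one, Complex.conj_ofReal,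
    Matrix.neg_apply, diagonal_conjTranspose, diagonal_mul, mul_diagonal, Pi.inv_apply, map_inv₀]
  refine h1.congr_deriv ?_
  simp only [Pi.add_apply, Complex.exp_add]
  field_simp
  ring

theorem hasDerivAt_Phi_x (p ξ₀ : Fin N → ℂ) (x t : ℝ) (i : Fin N) :
    HasDerivAt (fun y => Phi p ξ₀ y t i) ((diagonal p *ᵥ Phi p ξ₀ x t) i) x := by
  have h0 : HasDerivAt (fun y : ℝ => (y : ℂ)) 1 x := Complex.ofRealCLM.hasDerivAt
  have h1 := (((h0.const_mul (p i)).sub_const (1 / p i * (t : ℂ))).add_const (ξ₀ i)).cexp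
  refine h1.congr_deriv ?_
  simp only [mulVec_diagonal, Phi, xi]
  ring

theorem hasDerivAt_Phi_t (p ξ₀ : Fin N → ℂ) (x t : ℝ) (i : Fin N) :
    HasDerivAt (fun s => Phi p ξ₀ x s i) ((-(diagonal p⁻¹ *ᵥ Phi p ξ₀ x t)) i) t := by
  have h0 : HasDerivAt (fun y : ℝ => (y : ℂ)) 1 t := Complex.ofRealCLM.hasDerivAt
  have h1 := (((h0.const_mul (1 / p i)).const_sub (p i * (x : ℂ))).add_const (ξ₀ i)).cexp
  refine h1.congr_deriv ?_
  simp only [Pi.neg_apply, mulVec_diagonal, Phi, xi, Pi.inv_apply]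
  ring

/-- F and G both have the shape 1 + C M D with C and D constant in x and t. -/
theorem hasDerivAt_one_add_mul_mul {n : Type*} [Fintype n] [DecidableEq n] {X : ℝ → Matrix n n ℂ}
    {X' : Matrix n n ℂ} {t : ℝ} (C D : Matrix n n ℂ)
    (hX : ∀ i j, HasDerivAt (fun s => X s i j) (X' i j) t) (i j : n) :
    HasDerivAt (fun s => (1 + C * X s * D) i j) ((C * X' * D) i j) t := by
  simp only [Matrix.add_apply, Matrix.mul_apply]
  exact (HasDerivAt.fun_sum fun k _ => (HasDerivAt.fun_sum fun l _ =>
    (hX l k).const_mul _).mul_const _).const_add _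

theorem contDiff_one_add_mul_mul {n E : Type*} [Fintype n] [DecidableEq n] [NormedAddCommGroup E]
    [NormedSpace ℝ E] {k : ℕ∞} {X : E → Matrix n n ℂ} (C D : Matrix n n ℂ)
    (hX : ∀ i j, ContDiff ℝ k (fun s => X s i j)) (i j : n) :
    ContDiff ℝ k (fun s => (1 + C * X s * D) i j) := by
  simp only [Matrix.add_apply, Matrix.mul_apply]
  exact contDiff_const.add (ContDiff.sum fun k _ => (ContDiff.sum fun l _ =>
    contDiff_const.mul (hX l k)).mul contDiff_const)

theorem contDiff_xi (p ξ₀ : Fin N → ℂ) (i : Fin N) {k : ℕ∞} :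
    ContDiff ℝ k (fun z : ℝ × ℝ => xi p ξ₀ z.1 z.2 i) := by
  have h1 : ContDiff ℝ k (fun z : ℝ × ℝ => (z.1 : ℂ)) := Complex.ofRealCLM.contDiff.comp contDiff_fst
  have h2 : ContDiff ℝ k (fun z : ℝ × ℝ => (z.2 : ℂ)) := Complex.ofRealCLM.contDiff.comp contDiff_snd
  exact ((contDiff_const.mul h1).sub (contDiff_const.mul h2)).add contDiff_const

theorem contDiff_Phi (p ξ₀ : Fin N → ℂ) (i : Fin N) {k : ℕ∞} :
    ContDiff ℝ k (fun z : ℝ × ℝ => Phi p ξ₀ z.1 z.2 i) :=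
  (contDiff_xi p ξ₀ i).cexp

theorem contDiff_matM (p ξ₀ : Fin N → ℂ) (i j : Fin N) {k : ℕ∞} :
    ContDiff ℝ k (fun z : ℝ × ℝ => matM p ξ₀ z.1 z.2 i j) :=
  ((contDiff_xi p ξ₀ i).add
    (Complex.conjCLE.contDiff.comp (contDiff_xi p ξ₀ j))).cexp.div_const _

theorem F_eq_mul_mul {n : Type*} [Fintype n] [DecidableEq n] (P M B : Matrix n n ℂ) :
    Reduction.F P M B = 1 + (Complex.I • P) * M * B := by
  simp only [Reduction.F, Matrix.smul_mul]

theorem G_eq_mul_mul {n : Type*} [Fintype n] [DecidableEq n] (P M B : Matrix n n ℂ) :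
    Reduction.G P M B = 1 + (-Complex.I • 1) * M * (Pᴴ * B) := by
  simp only [Reduction.G, Matrix.smul_mul, Matrix.one_mul, Matrix.mul_assoc]

theorem hasDerivAt_u (σ : ℝ) (p α ξ₀ : Fin N → ℂ) (hp : ∀ i, p i ≠ 0)
    (hpp : ∀ i j, p i + conj (p j) ≠ 0) (x t : ℝ) :
    HasDerivAt (fun y => tauG σ p α ξ₀ y t / tauFStar σ p α ξ₀ y t)
      (Complex.I * (tauH σ p α ξ₀ x t / tauF σ p α ξ₀ x t +
        σ * (tauG σ p α ξ₀ x t / tauFStar σ p α ξ₀ x t) *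
        ((tauH σ p α ξ₀ x t / tauF σ p α ξ₀ x t) *
          conj (tauH σ p α ξ₀ x t / tauF σ p α ξ₀ x t)))) x := by
  have hF := det_F_ne_zero σ p α ξ₀ hpp x t
  have hG := det_G_ne_zero σ p α ξ₀ hpp x t
  have h := (reduction σ p α ξ₀ hpp x t).eq_u (diagonal_mul_diagonal_inv hp)
    (diagonal_inv_mul_diagonal hp) hF hG rfl rfl
  simp only [tauG_div_tauFStar σ p α ξ₀ hpp, tauH_div_tauF σ p α ξ₀ hpp]
  rw [vecMul_dotProduct_mulVec, ← h]
  have hX := hasDerivAt_one_add_mul_mul (-Complex.I • 1) ((diagonal p)ᴴ * matB σ p α)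
    (hasDerivAt_matM_x p ξ₀ hpp x t)
  simp only [← G_eq_mul_mul] at hX
  refine ((hasDerivAt_dotProduct_inv_mulVec (star α ᵥ* diagonal p⁻¹) hX
    (hasDerivAt_Phi_x p ξ₀ x t) hG).const_mul Complex.I).congr_deriv ?_
  generalize Reduction.G (diagonal p) (matM p ξ₀ x t) (matB σ p α) = Y
  generalize Phi p ξ₀ x t = φ
  have e : Y⁻¹ * (-Complex.I • 1 * vecMulVec φ (star φ) * ((diagonal p)ᴴ * matB σ p α)) * Y⁻¹ =
      -Complex.I • (Y⁻¹ * vecMulVec φ (star φ) * ((diagonal p)ᴴ * matB σ p α * Y⁻¹)) := by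
    simp only [Matrix.smul_mul, Matrix.mul_smul, Matrix.one_mul, Matrix.mul_assoc]
  rw [e, smul_mulVec, dotProduct_smul, dotProduct_mul_vecMulVec_mul_mulVec, mulVec_mulVec,
    vecMul_dotProduct_mulVec, vecMul_dotProduct_mulVec, smul_eq_mul, ← Matrix.mul_assoc]
  ring

theorem hasDerivAt_v (σ : ℝ) (p α ξ₀ : Fin N → ℂ) (hp : ∀ i, p i ≠ 0)
    (hpp : ∀ i j, p i + conj (p j) ≠ 0) (x t : ℝ) :
    HasDerivAt (fun s => tauH σ p α ξ₀ x s / tauF σ p α ξ₀ x s)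
      (Complex.I * (tauG σ p α ξ₀ x t / tauFStar σ p α ξ₀ x t +
        σ * (tauH σ p α ξ₀ x t / tauF σ p α ξ₀ x t) *
        ((tauG σ p α ξ₀ x t / tauFStar σ p α ξ₀ x t) *
          conj (tauG σ p α ξ₀ x t / tauFStar σ p α ξ₀ x t)))) t := by
  have hF := det_F_ne_zero σ p α ξ₀ hpp x t
  have hG := det_G_ne_zero σ p α ξ₀ hpp x t
  have h := (reduction σ p α ξ₀ hpp x t).eq_v (diagonal_mul_diagonal_inv hp)
    (diagonal_inv_mul_diagonal hp) hF hG rfl rfl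
  simp only [tauG_div_tauFStar σ p α ξ₀ hpp, tauH_div_tauF σ p α ξ₀ hpp]
  rw [vecMul_dotProduct_mulVec, ← h]
  have hX := hasDerivAt_one_add_mul_mul (Complex.I • diagonal p) (matB σ p α)
    (hasDerivAt_matM_t p ξ₀ hp hpp x t)
  simp only [← F_eq_mul_mul] at hX
  refine (hasDerivAt_dotProduct_inv_mulVec (star α) hX
    (hasDerivAt_Phi_t p ξ₀ x t) hF).congr_deriv ?_
  generalize Reduction.F (diagonal p) (matM p ξ₀ x t) (matB σ p α) = Y
  generalize Phi p ξ₀ x t = φ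
  -- The factor P in F cancels the left P⁻¹ in M_t, so F_t = -iφφ†(P⁻¹)†B.
  have e : Y⁻¹ * (Complex.I • diagonal p * -(diagonal p⁻¹ * vecMulVec φ (star φ) *
      (diagonal p⁻¹)ᴴ) * matB σ p α) * Y⁻¹ =
      -Complex.I • (Y⁻¹ * vecMulVec φ (star φ) * ((diagonal p⁻¹)ᴴ * matB σ p α * Y⁻¹)) := by
    simp only [Matrix.smul_mul, Matrix.mul_smul, Matrix.mul_neg, Matrix.neg_mul, neg_smul]
    congr 2
    calc _ = Y⁻¹ * ((diagonal p * diagonal p⁻¹) * vecMulVec φ (star φ) *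
          (diagonal p⁻¹)ᴴ * matB σ p α) * Y⁻¹ := by simp only [Matrix.mul_assoc]
      _ = _ := by
        rw [diagonal_mul_diagonal_inv hp, Matrix.one_mul]
        simp only [Matrix.mul_assoc]
  rw [e, smul_mulVec, dotProduct_smul, dotProduct_mul_vecMulVec_mul_mulVec, mulVec_neg,
    dotProduct_neg, mulVec_mulVec, smul_eq_mul]
  linear_combination -(star α ⬝ᵥ (Y⁻¹ * diagonal p⁻¹) *ᵥ φ) * Complex.I_sq

theorem isSolution (σ : ℝ) (p α ξ₀ : Fin N → ℂ) (hp : ∀ i, p i ≠ 0)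
    (hpp : ∀ i j, p i + conj (p j) ≠ 0) :
    IsSolution σ (fun x t => tauG σ p α ξ₀ x t / tauFStar σ p α ξ₀ x t)
      (fun x t => tauH σ p α ξ₀ x t / tauF σ p α ξ₀ x t) where
  contDiff_u := by
    simp only [tauG_div_tauFStar σ p α ξ₀ hpp]
    refine contDiff_const.mul (contDiff_dotProduct_inv_mulVec (k := 1) _ ?_
      (fun i => contDiff_Phi p ξ₀ i) fun z => det_G_ne_zero σ p α ξ₀ hpp z.1 z.2)
    simp only [G_eq_mul_mul]
    exact contDiff_one_add_mul_mul _ _ fun i j => contDiff_matM p ξ₀ i j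
  contDiff_v := by
    simp only [tauH_div_tauF σ p α ξ₀ hpp]
    refine contDiff_dotProduct_inv_mulVec (k := 1) _ ?_
      (fun i => contDiff_Phi p ξ₀ i) fun z => det_F_ne_zero σ p α ξ₀ hpp z.1 z.2
    simp only [F_eq_mul_mul]
    exact contDiff_one_add_mul_mul _ _ fun i j => contDiff_matM p ξ₀ i j
  eq_u x t := by
    rw [(hasDerivAt_u σ p α ξ₀ hp hpp x t).deriv, ← Complex.normSq_eq_norm_sq, ← Complex.mul_conj,
      ← mul_assoc, Complex.I_mul_I]
    ring
  eq_v x t := by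
    rw [(hasDerivAt_v σ p α ξ₀ hp hpp x t).deriv, ← Complex.normSq_eq_norm_sq, ← Complex.mul_conj,
      ← mul_assoc, Complex.I_mul_I]
    ring

end MassiveThirring

theorem mainTheorem1 (N : ℕ) (σ : ℝ) (hσ : σ = 1 ∨ σ = -1) (p α ξ₀ : Fin N → ℂ)
    (hp : ∀ i, p i ≠ 0) (hpp : ∀ i j, p i + conj (p j) ≠ 0) :
    (∀ x t : ℝ, MassiveThirring.tauF σ p α ξ₀ x t ≠ 0 ∧
      conj (MassiveThirring.tauF σ p α ξ₀ x t) = MassiveThirring.tauFStar σ p α ξ₀ x t) ∧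
    MassiveThirring.IsSolution σ
      (fun x t => MassiveThirring.tauG σ p α ξ₀ x t / MassiveThirring.tauFStar σ p α ξ₀ x t)
      (fun x t => MassiveThirring.tauH σ p α ξ₀ x t / MassiveThirring.tauF σ p α ξ₀ x t) := by
  refine ⟨fun x t => ?_, MassiveThirring.isSolution σ p α ξ₀ hp hpp⟩
  rw [MassiveThirring.tauF_eq, MassiveThirring.tauFStar_eq]
  exact ⟨MassiveThirring.det_F_ne_zero σ p α ξ₀ hpp x t,
    (MassiveThirring.reduction σ p α ξ₀ hpp x t).conj_det_F⟩
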